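/- Let $\mathbb K=\mathbb R$ or $\mathbb C$ and $N\in\mathbb N$. For Banach spaces $X_1,\dots,X_N$ over $\mathbb K$ write $\mathbf X=X_1\times\cdots\times X_N$ and let $\mathcal L(\mathbf X)$ be the space of continuous $N$-linear forms $\Phi:\mathbf X\to\mathbb K$ with the supremum norm. A \emph{normed ideal of $N$-linear forms} $(\mathfrak U,\|\cdot\|_{\mathfrak U})$ assigns to every $N$-tuple of Banach spaces a linear subspace $\mathfrak U(\mathbf X)\subseteq\mathcal L(\mathbf X)$ and a norm $\|\cdot\|_{\mathfrak U}$ on it such that (a) if $\Phi\in\mathfrak U(\mathbf X)$ and $T_i:Z_i\to X_i$ are bounded linear operators between Banach spaces, then $\Phi\circ(T_1,\dots,T_N)\in\mathfrak U(Z_1\times\cdots\times Z_N)$ with $\|\Phi\circ(T_1,\dots,T_N)\|_{\mathfrak U}\le\|\Phi\|_{\mathfrak U}\|T_1\|\cdots\|T_N\|$; (b) the form $(z_1,\dots,z_N)\mapsto z_1\cdots z_N$ belongs to $\mathfrak U(\mathbb K^N)$ and has norm one. For $J\subseteq\{1,\dots,N\}$ let $P_J:\mathbf X\to\mathbf X$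 keep the coordinates in $J$ and replace the others by $0$, and let $J^c$ be the complement of $J$. For $\mathbf a\in\mathbf X$ and $\Phi\in\mathcal L(\mathbf X)$ put $$V_{J,\mathbf a}(\Phi)(\mathbf x)=\Phi\bigl(P_J(\mathbf x)+P_{J^c}(\mathbf a)\bigr)\,\Phi\bigl(P_J(\mathbf a)+P_{J^c}(\mathbf x)\bigr).$$ The ideal $\mathfrak U$ is \emph{stable at $\mathbf X$} if there is $K>0$ such that for all $\mathbf a=(a_1,\dots,a_N)\in\mathbf X$, all $J\subseteq\{1,\dots,N\}$ and all $\Phi\in\mathfrak U(\mathbf X)$, $$V_{J,\mathbf a}(\Phi)\in\mathfrak U(\mathbf X)\quad\text{and}\quad\|V_{J,\mathbf a}(\Phi)\|_{\mathfrak U}\le K\,\|\Phi\|_{\mathfrak U}^2\,\|a_1\|\cdots\|a_N\|.$$ Each of the $N!$ orderings $i_1,\dots,i_N$ of the variables gives an \emph{Arens extension} $\overline\Phi:X_1''\times\cdots\times X_N''\to\mathbb K$ of $\Phi$, namely $\overline\Phi(x_1'',\dots,x_N'')=\lim_{\alpha_{i_1}}\cdots\lim_{\alpha_{i_N}}\Phi(x_{1,\alpha_1},\dots,x_{N,\alpha_N})$,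 where $(x_{j,\alpha_j})_{\alpha_j}$ is a bounded net in $X_j$ converging weak-star to $x_j''$. \textbf{Theorem.} Let $\mathfrak U$ be a normed ideal of $N$-linear forms and $X_1,\dots,X_N$ Banach spaces such that $(\mathfrak U(\mathbf X),\|\cdot\|_{\mathfrak U})$ is complete (as is the case for every Banach ideal $\mathfrak U$) and $\mathfrak U$ is stable at $\mathbf X$. Then for every $\Phi\in\mathfrak U(\mathbf X)$ and every $\varepsilon>0$ there is $\Psi\in\mathfrak U(\mathbf X)$ with $\|\Phi-\Psi\|_{\mathfrak U}<\varepsilon$ such that all $N!$ Arens extensions of $\Psi$ attain their supremum norm at one and the same $N$-tuple, i.e. there is a single $(z_1,\dots,z_N)\in B_{X_1''}\times\cdots\times B_{X_N''}$ at which the absolute value of each of these extensions attains its maximum over $B_{X_1''}\times\cdots\times B_{X_N''}$, where $B_E$ is the closed unit ball of $E$. -/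

import Mathlib

open Filter Topology

universe u

namespace MultilinearLindenstrauss

noncomputable section

/-- The space `ℒ(X₁ × ⋯ × X_N)` of continuous `N`-linear forms. The norm provided by Mathlib is
the supremum norm, i.e. the least `C ≥ 0` with `‖Φ x‖ ≤ C ∏ i, ‖x i‖` for all `x`. -/
abbrev Form (𝕜 : Type) [RCLike 𝕜] {N : ℕ} (X : Fin N → Type u)
    [∀ i, NormedAddCommGroup (X i)] [∀ i, NormedSpace 𝕜 (X i)] : Type u :=
  ContinuousMultilinearMap 𝕜 X 𝕜

/-- The bidual `X''` of a normed space. -/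
abbrev Bidual (𝕜 : Type) [RCLike 𝕜] (X : Type u) [NormedAddCommGroup X] [NormedSpace 𝕜 X] :
    Type u :=
  StrongDual 𝕜 (StrongDual 𝕜 X)

/-! ### Arens extensions -/

/-- Evaluation at `z ∈ X₁'' × ⋯ × X_N''` of the Arens extension in which the first variable
corresponds to the outermost limit and the last variable to the innermost one, as a functional on
the space of `N`-linear forms. It is given by the recursion
`Φ̄(z₁, …, z_N) = z₁ (x₁ ↦ Φ(x₁, ·, …, ·)̄ (z₂, …, z_N))`. Since `z₁ φ = lim_α φ(x_α)` for every net
`(x_α)` that is weak-star convergent to `z₁` and every `φ ∈ X₁'`, this is the iterated limit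
`lim_{α₁} ⋯ lim_{α_N} Φ(x_{1,α₁}, …, x_{N,α_N})`; see `tendsto_arensEval`. -/
def arensEval (𝕜 : Type) [RCLike 𝕜] : {N : ℕ} → (X : Fin N → Type u) →
    [∀ i, NormedAddCommGroup (X i)] → [∀ i, NormedSpace 𝕜 (X i)] →
    (∀ i, Bidual 𝕜 (X i)) → (Form 𝕜 X →L[𝕜] 𝕜)
  | 0, X, _, _, _ => ContinuousMultilinearMap.apply 𝕜 X 𝕜 0
  | _ + 1, X, _, _, z =>
      (z 0).comp
        ((ContinuousLinearMap.compL 𝕜 (X 0) (Form 𝕜 fun i => X (Fin.succ i)) 𝕜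
            (arensEval 𝕜 (fun i => X (Fin.succ i)) fun i => z (Fin.succ i))).comp
          (continuousMultilinearCurryLeftEquiv 𝕜 X 𝕜).toContinuousLinearEquiv.toContinuousLinearMap)

theorem arensEval_zero (𝕜 : Type) [RCLike 𝕜] (X : Fin 0 → Type u)
    [∀ i, NormedAddCommGroup (X i)] [∀ i, NormedSpace 𝕜 (X i)]
    (z : ∀ i, Bidual 𝕜 (X i)) (Φ : Form 𝕜 X) : arensEval 𝕜 X z Φ = Φ 0 := rfl

theorem arensEval_succ (𝕜 : Type) [RCLike 𝕜] {N : ℕ} (X : Fin (N + 1) → Type u)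
    [∀ i, NormedAddCommGroup (X i)] [∀ i, NormedSpace 𝕜 (X i)]
    (z : ∀ i, Bidual 𝕜 (X i)) (Φ : Form 𝕜 X) :
    arensEval 𝕜 X z Φ =
      z 0 ((arensEval 𝕜 (fun i => X (Fin.succ i)) fun i => z (Fin.succ i)).comp Φ.curryLeft) := rfl

/-- Each application of the recursion is a weak-star limit in one variable: if `x α → z 0`
weak-star, then `Φ̄(z) = lim_α Φ(x α, ·, …, ·)̄ (z₂, …, z_N)`. -/
theorem tendsto_arensEval (𝕜 : Type) [RCLike 𝕜] {N : ℕ} (X : Fin (N + 1) → Type u)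
    [∀ i, NormedAddCommGroup (X i)] [∀ i, NormedSpace 𝕜 (X i)]
    (z : ∀ i, Bidual 𝕜 (X i)) (Φ : Form 𝕜 X) {A : Type*} (l : Filter A) (x : A → X 0)
    (hx : ∀ φ : StrongDual 𝕜 (X 0), Tendsto (fun α => φ (x α)) l (𝓝 (z 0 φ))) :
    Tendsto (fun α => arensEval 𝕜 (fun i => X (Fin.succ i)) (fun i => z (Fin.succ i))
      (Φ.curryLeft (x α))) l (𝓝 (arensEval 𝕜 X z Φ)) := by
  rw [arensEval_succ]
  exact hx _

/-- Reordering of the variables: `Φ` regarded as a form on `X_{σ⁻¹(1)} × ⋯ × X_{σ⁻¹(N)}`, so that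
the variable `i` of `Φ` stands in place `σ i`. -/
def reorder {𝕜 : Type} [RCLike 𝕜] {N : ℕ} {X : Fin N → Type u}
    [∀ i, NormedAddCommGroup (X i)] [∀ i, NormedSpace 𝕜 (X i)]
    (σ : Equiv.Perm (Fin N)) (Φ : Form 𝕜 X) : Form 𝕜 fun k => X (σ.symm k) where
  toMultilinearMap :=
    MultilinearMap.domDomCongrLinearEquiv' 𝕜 𝕜 X 𝕜 σ Φ.toMultilinearMap
  cont := by
    refine Φ.cont.comp (continuous_pi fun i => ?_)
    obtain ⟨k, rfl⟩ := σ.symm.surjective i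
    simp only [Equiv.piCongrLeft'_symm_apply_apply]
    exact continuous_apply k

theorem reorder_apply {𝕜 : Type} [RCLike 𝕜] {N : ℕ} {X : Fin N → Type u}
    [∀ i, NormedAddCommGroup (X i)] [∀ i, NormedSpace 𝕜 (X i)]
    (σ : Equiv.Perm (Fin N)) (Φ : Form 𝕜 X) (x : ∀ i, X i) :
    reorder σ Φ (fun k => x (σ.symm k)) = Φ x := by
  change Φ ((σ.piCongrLeft' X).symm (σ.piCongrLeft' X x)) = Φ x
  rw [Equiv.symm_apply_apply]

/-- The Arens extension of `Φ` to `X₁'' × ⋯ × X_N''` for the order of the variables given by `σ`: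
the limit in the variable `i` is the one in place `σ i`, counted from the outermost to the
innermost. As `σ` runs over all permutations, these are the `N!` Arens extensions of `Φ`. -/
def arens {𝕜 : Type} [RCLike 𝕜] {N : ℕ} {X : Fin N → Type u}
    [∀ i, NormedAddCommGroup (X i)] [∀ i, NormedSpace 𝕜 (X i)]
    (σ : Equiv.Perm (Fin N)) (Φ : Form 𝕜 X) (z : ∀ i, Bidual 𝕜 (X i)) : 𝕜 :=
  arensEval 𝕜 (fun k => X (σ.symm k)) (fun k => z (σ.symm k)) (reorder σ Φ)

/-- All the Arens extensions of `Φ` attain their supremum norm at the same `N`-tuple: there is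
`z` in `B_{X₁''} × ⋯ × B_{X_N''}` at which every `|Φ̄_σ|` attains its maximum over
`B_{X₁''} × ⋯ × B_{X_N''}`. -/
def ArensAttain {𝕜 : Type} [RCLike 𝕜] {N : ℕ} {X : Fin N → Type u}
    [∀ i, NormedAddCommGroup (X i)] [∀ i, NormedSpace 𝕜 (X i)] (Φ : Form 𝕜 X) : Prop :=
  ∃ z : ∀ i, Bidual 𝕜 (X i), (∀ i, ‖z i‖ ≤ 1) ∧
    ∀ σ : Equiv.Perm (Fin N), ∀ w : ∀ i, Bidual 𝕜 (X i), (∀ i, ‖w i‖ ≤ 1) →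
      ‖arens σ Φ w‖ ≤ ‖arens σ Φ z‖

/-! ### Ideals of `N`-linear forms -/

/-- The `N`-linear form `(z₁, …, z_N) ↦ z₁ ⋯ z_N` on `𝕜 × ⋯ × 𝕜`, where `ULift 𝕜` is the Banach
space `𝕜` placed in the universe of the spaces under consideration. -/
def mulForm (𝕜 : Type) [RCLike 𝕜] (N : ℕ) : Form 𝕜 fun _ : Fin N => ULift.{u} 𝕜 :=
  (ContinuousMultilinearMap.mkPiAlgebra 𝕜 (Fin N) 𝕜).compContinuousLinearMap
    fun _ => (ContinuousLinearEquiv.ulift (R₁ := 𝕜) (M₁ := 𝕜)).toContinuousLinearMap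

theorem mulForm_apply (𝕜 : Type) [RCLike 𝕜] (N : ℕ) (z : Fin N → ULift.{u} 𝕜) :
    mulForm 𝕜 N z = ∏ i, (z i).down := by
  simp [mulForm, ContinuousLinearEquiv.ulift]

/-- A normed ideal `(𝔘, ‖·‖_𝔘)` of `N`-linear forms. Composition on the left with an operator
`S : 𝕜 → 𝕜` is multiplication by a scalar and therefore needs no separate axiom. -/
structure NormedIdeal (𝕜 : Type) [RCLike 𝕜] (N : ℕ) where
  /-- The space `𝔘(X₁ × ⋯ × X_N)`, a linear subspace of `ℒ(X₁ × ⋯ × X_N)`. -/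
  space : ∀ (X : Fin N → Type u) [∀ i, NormedAddCommGroup (X i)] [∀ i, NormedSpace 𝕜 (X i)]
    [∀ i, CompleteSpace (X i)], Submodule 𝕜 (Form 𝕜 X)
  /-- The ideal norm `‖·‖_𝔘` on `𝔘(X₁ × ⋯ × X_N)`. -/
  nrm : ∀ (X : Fin N → Type u) [∀ i, NormedAddCommGroup (X i)] [∀ i, NormedSpace 𝕜 (X i)]
    [∀ i, CompleteSpace (X i)], Seminorm 𝕜 (space X)
  nrm_eq_zero : ∀ (X : Fin N → Type u) [∀ i, NormedAddCommGroup (X i)]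
    [∀ i, NormedSpace 𝕜 (X i)] [∀ i, CompleteSpace (X i)] (Φ : space X), nrm X Φ = 0 → Φ = 0
  /-- The ideal property. -/
  comp_mem : ∀ (X Z : Fin N → Type u) [∀ i, NormedAddCommGroup (X i)] [∀ i, NormedSpace 𝕜 (X i)]
    [∀ i, CompleteSpace (X i)] [∀ i, NormedAddCommGroup (Z i)] [∀ i, NormedSpace 𝕜 (Z i)]
    [∀ i, CompleteSpace (Z i)] (T : ∀ i, Z i →L[𝕜] X i) (Φ : space X),
    ∃ h : (Φ : Form 𝕜 X).compContinuousLinearMap T ∈ space Z,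
      nrm Z ⟨_, h⟩ ≤ nrm X Φ * ∏ i, ‖T i‖
  /-- The form `z₁ ⋯ z_N` belongs to the ideal and has norm one. -/
  mul_mem : ∃ h : mulForm 𝕜 N ∈ space (fun _ => ULift.{u} 𝕜), nrm _ ⟨_, h⟩ = 1

/-- The space `(𝔘(X), ‖·‖_𝔘)` is complete: every `‖·‖_𝔘`-Cauchy sequence converges. -/
def NormedIdeal.CompleteAt {𝕜 : Type} [RCLike 𝕜] {N : ℕ} (U : NormedIdeal.{u} 𝕜 N)
    (X : Fin N → Type u) [∀ i, NormedAddCommGroup (X i)] [∀ i, NormedSpace 𝕜 (X i)]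
    [∀ i, CompleteSpace (X i)] : Prop :=
  ∀ f : ℕ → U.space X,
    (∀ ε > 0, ∃ n₀, ∀ m ≥ n₀, ∀ n ≥ n₀, U.nrm X (f m - f n) < ε) →
    ∃ g : U.space X, Tendsto (fun n => U.nrm X (f n - g)) atTop (𝓝 0)

/-! ### Stability -/

/-- The projection `P_J` of `X₁ × ⋯ × X_N` which keeps the coordinates in `J` and replaces the
others by `0`. -/
def proj {N : ℕ} {X : Fin N → Type u} [∀ i, NormedAddCommGroup (X i)]
    (J : Finset (Fin N)) (x : ∀ i, X i) : ∀ i, X i :=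
  fun k => if k ∈ J then x k else 0

theorem proj_update_of_mem {N : ℕ} {X : Fin N → Type u} [∀ i, NormedAddCommGroup (X i)]
    [DecidableEq (Fin N)] (J : Finset (Fin N)) (x b : ∀ i, X i) (i : Fin N) (hi : i ∈ J)
    (hb : b i = 0) (t : X i) :
    proj J (Function.update x i t) + b = Function.update (proj J x + b) i t := by
  funext k
  by_cases hk : k = i
  · subst hk; simp [proj, hi, hb]
  · simp [proj, hk]

theorem proj_update_of_notMem {N : ℕ} {X : Fin N → Type u} [∀ i, NormedAddCommGroup (X i)]
    [DecidableEq (Fin N)] (J : Finset (Fin N)) (x : ∀ i, X i) (i : Fin N) (hi : i ∉ J) (t : X i) :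
    proj J (Function.update x i t) = proj J x := by
  funext k
  by_cases hk : k = i
  · subst hk; simp [proj, hi]
  · simp [proj, hk]

theorem continuous_proj {N : ℕ} {X : Fin N → Type u} [∀ i, NormedAddCommGroup (X i)]
    (J : Finset (Fin N)) : Continuous (proj J : (∀ i, X i) → ∀ i, X i) := by
  refine continuous_pi fun k => ?_
  by_cases hk : k ∈ J
  · simpa [proj, hk] using continuous_apply k
  · simpa [proj, hk] using continuous_const

/-- The `N`-linear form
`V_{J,a}(Φ)(x) = Φ(P_J(x) + P_{Jᶜ}(a)) * Φ(P_J(a) + P_{Jᶜ}(x))`. -/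
def V {𝕜 : Type} [RCLike 𝕜] {N : ℕ} {X : Fin N → Type u}
    [∀ i, NormedAddCommGroup (X i)] [∀ i, NormedSpace 𝕜 (X i)]
    (J : Finset (Fin N)) (a : ∀ i, X i) (Φ : Form 𝕜 X) : Form 𝕜 X where
  toFun x := Φ (proj J x + proj Jᶜ a) * Φ (proj J a + proj Jᶜ x)
  map_update_add' := @fun inst x i s t => by
    obtain rfl : inst = instDecidableEqFin N := Subsingleton.elim _ _
    by_cases hi : i ∈ J
    · have hc : i ∉ Jᶜ := by simpa using hi
      have hb : (proj Jᶜ a : ∀ i, X i) i = 0 := by simp [proj, hi]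
      simp only [proj_update_of_mem J x _ i hi hb, proj_update_of_notMem Jᶜ x i hc,
        Φ.map_update_add, add_mul]
    · have hc : i ∈ Jᶜ := by simpa using hi
      have hb : (proj J a : ∀ i, X i) i = 0 := by simp [proj, hi]
      simp only [add_comm (proj J a), proj_update_of_mem Jᶜ x _ i hc hb,
        proj_update_of_notMem J x i hi, Φ.map_update_add, mul_add]
  map_update_smul' := @fun inst x i c t => by
    obtain rfl : inst = instDecidableEqFin N := Subsingleton.elim _ _
    by_cases hi : i ∈ J
    · have hc : i ∉ Jᶜ := by simpa using hi
      have hb : (proj Jᶜ a : ∀ i, X i) i = 0 := by simp [proj, hi]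
      simp only [proj_update_of_mem J x _ i hi hb, proj_update_of_notMem Jᶜ x i hc,
        Φ.map_update_smul, smul_mul_assoc]
    · have hc : i ∈ Jᶜ := by simpa using hi
      have hb : (proj J a : ∀ i, X i) i = 0 := by simp [proj, hi]
      simp only [add_comm (proj J a), proj_update_of_mem Jᶜ x _ i hc hb,
        proj_update_of_notMem J x i hi, Φ.map_update_smul, mul_smul_comm]
  cont := by
    exact (Φ.cont.comp ((continuous_proj J).add continuous_const)).mul
      (Φ.cont.comp (continuous_const.add (continuous_proj Jᶜ)))

theorem V_apply {𝕜 : Type} [RCLike 𝕜] {N : ℕ} {X : Fin N → Type u}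
    [∀ i, NormedAddCommGroup (X i)] [∀ i, NormedSpace 𝕜 (X i)]
    (J : Finset (Fin N)) (a : ∀ i, X i) (Φ : Form 𝕜 X) (x : ∀ i, X i) :
    V J a Φ x = Φ (proj J x + proj Jᶜ a) * Φ (proj J a + proj Jᶜ x) := rfl

/-- The ideal `𝔘` is stable at `X₁ × ⋯ × X_N`. -/
def NormedIdeal.StableAt {𝕜 : Type} [RCLike 𝕜] {N : ℕ} (U : NormedIdeal.{u} 𝕜 N)
    (X : Fin N → Type u) [∀ i, NormedAddCommGroup (X i)] [∀ i, NormedSpace 𝕜 (X i)]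
    [∀ i, CompleteSpace (X i)] : Prop :=
  ∃ K : ℝ, 0 < K ∧ ∀ (a : ∀ i, X i) (J : Finset (Fin N)) (Φ : U.space X),
    ∃ h : V J a (Φ : Form 𝕜 X) ∈ U.space X,
      U.nrm X ⟨_, h⟩ ≤ K * U.nrm X Φ ^ 2 * ∏ i, ‖a i‖

end

end MultilinearLindenstrauss

namespace MultilinearLindenstrauss

open Function

/-! ### Multilinear forms on the unit ball and the one-step perturbation. -/

section Forms

variable {𝕜 : Type} [RCLike 𝕜] {N : ℕ} {X : Fin N → Type u}
  [∀ i, NormedAddCommGroup (X i)] [∀ i, NormedSpace 𝕜 (X i)]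

/-! If `a` almost norms `Φ`, add a small multiple of the sum of the forms `V {i} a Φ`, with a phase
aligning `Φ(a)²` with `Φ(a)`. The new form is large at `a`; where it is almost as large at some `x`,
every `update x i (a i)` must almost norm `Φ` (`exists_perturbation`). Stability keeps the
perturbation in the ideal.

Iterating with rapidly decreasing steps gives, by completeness, a limit `Ψ` and points `a n`. The
defect `d(x) = ‖Ψ‖ - |Ψ(x)|` then obeys `d(update x i (a n i)) ≤ c n * d(x) + e n` with `e n → 0`;
`c n` may be unbounded. Start from `a m`, replace all coordinates by `a (n i) i`, and let `m → ∞`: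
what remains is an iterated error in which each `e` is multiplied only by the `c` of variables
further out. Taking the limits from the innermost outwards kills it. As any coordinate may be
replaced at any time, this works for every order of the variables, with the same weak-star limits `z
i` of `a n i`. -/

theorem norm_apply_le_of_ball (Φ : Form 𝕜 X) {x : ∀ i, X i} (hx : ∀ i, ‖x i‖ ≤ 1) :
    ‖Φ x‖ ≤ ‖Φ‖ :=
  Φ.unit_le_opNorm ((pi_norm_le_iff_of_nonneg zero_le_one).2 hx)

theorem norm_le_of_forall_ball (Φ : Form 𝕜 X) {M : ℝ} (hM : 0 ≤ M)
    (h : ∀ x : ∀ i, X i, (∀ i, ‖x i‖ ≤ 1) → ‖Φ x‖ ≤ M) : ‖Φ‖ ≤ M := by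
  refine Φ.opNorm_le_bound hM fun x => ?_
  -- The identity survives `x i = 0`, since then both factors vanish.
  have hx : x = fun i => ((‖x i‖ : ℝ) : 𝕜) • ((‖x i‖⁻¹ : ℝ) : 𝕜) • x i := by
    funext i
    by_cases hi : x i = 0
    · simp [hi]
    · rw [smul_smul, ← RCLike.ofReal_mul, mul_inv_cancel₀ (norm_ne_zero_iff.2 hi)]
      simp
  have hy := h (fun i => ((‖x i‖⁻¹ : ℝ) : 𝕜) • x i) fun i => by
    rw [norm_smul, RCLike.norm_ofReal, abs_inv, abs_norm]
    exact inv_mul_le_one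
  rw [hx, Φ.map_smul_univ, ← hx, norm_smul, norm_prod, mul_comm]
  simp only [RCLike.norm_ofReal, abs_norm]
  exact mul_le_mul_of_nonneg_right hy (Finset.prod_nonneg fun i _ => norm_nonneg _)

theorem exists_almost_norming (Φ : Form 𝕜 X) {δ : ℝ} (hδ : 0 < δ) :
    ∃ a : ∀ i, X i, (∀ i, ‖a i‖ ≤ 1) ∧ ‖Φ‖ - δ ≤ ‖Φ a‖ := by
  by_contra! h
  have h0 : 0 ≤ ‖Φ‖ - δ := (norm_nonneg _).trans (h 0 (by simp)).le
  linarith [norm_le_of_forall_ball Φ h0 fun x hx => (h x hx).le]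

theorem proj_singleton_add (x a : ∀ i, X i) (i : Fin N) :
    proj {i} a + proj {i}ᶜ x = update x i (a i) := by
  funext k
  by_cases hk : k = i
  · subst hk; simp [proj]
  · simp [proj, hk]

theorem V_singleton_apply (Φ : Form 𝕜 X) (a x : ∀ i, X i) (i : Fin N) :
    V {i} a Φ x = Φ (update a i (x i)) * Φ (update x i (a i)) := by
  rw [V_apply, proj_singleton_add, proj_singleton_add]

theorem norm_update_le_one {a x : ∀ i, X i} (ha : ∀ i, ‖a i‖ ≤ 1) (hx : ∀ i, ‖x i‖ ≤ 1)
    (i : Fin N) (k : Fin N) : ‖update x i (a i) k‖ ≤ 1 := by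
  by_cases hk : k = i
  · subst hk; simpa using ha k
  · simpa [hk] using hx k

/-- A unimodular scalar aligning `c ^ 2` with `c`. -/
theorem exists_phase (c : 𝕜) : ∃ u : 𝕜, ‖u‖ ≤ 1 ∧
    ∀ t : ℝ, 0 ≤ t → ‖c + (t : 𝕜) * u * (c * c)‖ = ‖c‖ + t * ‖c‖ ^ 2 := by
  by_cases hc : c = 0
  · exact ⟨0, by simp, by simp [hc]⟩
  have hn : ‖c‖ ≠ 0 := norm_ne_zero_iff.2 hc
  refine ⟨(‖c‖ : 𝕜) * c⁻¹, by simp [hn], fun t ht => ?_⟩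
  have : c + (t : 𝕜) * ((‖c‖ : 𝕜) * c⁻¹) * (c * c) = c * ((1 + t * ‖c‖ : ℝ) : 𝕜) := by
    push_cast; field_simp
  rw [this, norm_mul, RCLike.norm_ofReal, abs_of_nonneg (by positivity)]
  ring

/-- Compare a lower bound for `Φ'` at `a`, where all `N` added terms equal `Φ(a)²` up to the common
factor, with an upper bound at `x`, where a defect of `Φ` at `update x i (a i)` costs `ε‖Φ‖` times
that defect. -/
theorem exists_perturbation (Φ : Form 𝕜 X) {ε δ : ℝ} (hε : 0 < ε) (hδ : 0 < δ) :
    ∃ (a : ∀ i, X i) (u : 𝕜), (∀ i, ‖a i‖ ≤ 1) ∧ ‖u‖ ≤ 1 ∧ ‖Φ‖ - δ ≤ ‖Φ a‖ ∧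
      ∀ Φ' : Form 𝕜 X, Φ' = Φ + ((ε : 𝕜) * u) • ∑ i, V {i} a Φ →
        ∀ x : ∀ i, X i, (∀ i, ‖x i‖ ≤ 1) → ∀ i,
          ε * (‖Φ‖ * (‖Φ‖ - ‖Φ (update x i (a i))‖)) ≤
            2 * N * ‖Φ‖ * δ * ε + δ + (‖Φ'‖ - ‖Φ' x‖) := by
  obtain ⟨a, ha, hΦa⟩ := exists_almost_norming Φ hδ
  obtain ⟨u, hu, hphase⟩ := exists_phase (Φ a)
  refine ⟨a, u, ha, hu, hΦa, fun Φ' hΦ' x hx i => ?_⟩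
  have happ : ∀ y, Φ' y = Φ y + (ε : 𝕜) * u * ∑ j, Φ (update a j (y j)) * Φ (update y j (a j)) := by
    intro y
    simp [hΦ', V_singleton_apply]
  have hle := norm_apply_le_of_ball Φ ha
  have hN : (0 : ℝ) ≤ N := N.cast_nonneg
  have hlow : ‖Φ a‖ + ε * N * ‖Φ a‖ ^ 2 ≤ ‖Φ'‖ := by
    refine le_trans (le_of_eq ?_) (norm_apply_le_of_ball Φ' ha)
    rw [happ, ← hphase (ε * N) (by positivity)]
    simp
    ring_nf
  have hterm : ∀ j, ‖Φ (update a j (x j)) * Φ (update x j (a j))‖ ≤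
      ‖Φ‖ * ‖Φ (update x j (a j))‖ := fun j => by
    rw [norm_mul]
    exact mul_le_mul_of_nonneg_right
      (norm_apply_le_of_ball Φ (norm_update_le_one hx ha j)) (norm_nonneg _)
  -- Each of the `N` terms is at most `‖Φ‖²`; only the loss in the `i`-th one is kept.
  have hsum : ‖∑ j, Φ (update a j (x j)) * Φ (update x j (a j))‖ ≤
      N * ‖Φ‖ ^ 2 - ‖Φ‖ * (‖Φ‖ - ‖Φ (update x i (a i))‖) := by
    have h1 : ∑ j, ‖Φ‖ * (‖Φ‖ - ‖Φ (update x j (a j))‖) ≥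
        ‖Φ‖ * (‖Φ‖ - ‖Φ (update x i (a i))‖) :=
      Finset.single_le_sum (f := fun j => ‖Φ‖ * (‖Φ‖ - ‖Φ (update x j (a j))‖))
        (fun j _ => mul_nonneg (norm_nonneg _)
          (sub_nonneg.2 (norm_apply_le_of_ball Φ (norm_update_le_one ha hx j))))
        (Finset.mem_univ i)
    have h2 : ∑ j, ‖Φ‖ * (‖Φ‖ - ‖Φ (update x j (a j))‖) =
        N * ‖Φ‖ ^ 2 - ∑ j, ‖Φ‖ * ‖Φ (update x j (a j))‖ := by
      simp only [mul_sub, Finset.sum_sub_distrib, Finset.sum_const, Finset.card_univ,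
        Fintype.card_fin, nsmul_eq_mul]
      ring
    have h3 := norm_sum_le_of_le Finset.univ fun j _ => hterm j
    linarith
  have hup : ‖Φ' x‖ ≤ ‖Φ‖ + ε * (N * ‖Φ‖ ^ 2 - ‖Φ‖ * (‖Φ‖ - ‖Φ (update x i (a i))‖)) := by
    rw [happ]
    refine (norm_add_le _ _).trans (add_le_add (norm_apply_le_of_ball Φ hx) ?_)
    rw [norm_mul, norm_mul, RCLike.norm_ofReal, abs_of_pos hε]
    exact mul_le_mul (mul_le_of_le_one_right hε.le hu) hsum (norm_nonneg _) hε.le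
  have hsq : ‖Φ‖ ^ 2 - 2 * ‖Φ‖ * δ ≤ ‖Φ a‖ ^ 2 := by
    nlinarith [norm_nonneg (Φ a), norm_nonneg Φ]
  have := mul_le_mul_of_nonneg_left hsq (mul_nonneg hε.le hN)
  linarith

end Forms

/-! ### Arens extensions and iterated limits of the defect. -/

section Arens

variable {𝕜 : Type} [RCLike 𝕜]

theorem norm_reorder_le {N : ℕ} {X : Fin N → Type u}
    [∀ i, NormedAddCommGroup (X i)] [∀ i, NormedSpace 𝕜 (X i)]
    (σ : Equiv.Perm (Fin N)) (Φ : Form 𝕜 X) : ‖reorder σ Φ‖ ≤ ‖Φ‖ := by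
  refine norm_le_of_forall_ball _ (norm_nonneg _) fun y hy => ?_
  obtain ⟨x, rfl⟩ := (σ.piCongrLeft' X).surjective y
  refine (congrArg norm (reorder_apply σ Φ x)).le.trans (norm_apply_le_of_ball Φ fun i => ?_)
  obtain ⟨k, rfl⟩ := σ.symm.surjective i
  exact hy k

theorem norm_arensEval_le {N : ℕ} (X : Fin N → Type u)
    [∀ i, NormedAddCommGroup (X i)] [∀ i, NormedSpace 𝕜 (X i)]
    (z : ∀ i, Bidual 𝕜 (X i)) (hz : ∀ i, ‖z i‖ ≤ 1) (Φ : Form 𝕜 X) :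
    ‖arensEval 𝕜 X z Φ‖ ≤ ‖Φ‖ := by
  induction N with
  | zero => exact norm_apply_le_of_ball Φ (by simp)
  | succ N ih =>
    rw [arensEval_succ]
    refine ((z 0).le_of_opNorm_le (hz 0) _).trans ?_
    rw [one_mul]
    refine ContinuousLinearMap.opNorm_le_bound _ (norm_nonneg _) fun x => ?_
    refine (ih (fun i => X i.succ) (fun i => z i.succ) (fun i => hz i.succ)
      (Φ.curryLeft x)).trans ?_
    refine (Φ.curryLeft.le_opNorm x).trans_eq ?_
    rw [ContinuousMultilinearMap.curryLeft_norm]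

theorem norm_arens_le {N : ℕ} {X : Fin N → Type u}
    [∀ i, NormedAddCommGroup (X i)] [∀ i, NormedSpace 𝕜 (X i)]
    (σ : Equiv.Perm (Fin N)) (Φ : Form 𝕜 X) (z : ∀ i, Bidual 𝕜 (X i)) (hz : ∀ i, ‖z i‖ ≤ 1) :
    ‖arens σ Φ z‖ ≤ ‖Φ‖ :=
  (norm_arensEval_le _ _ (fun k => hz (σ.symm k)) _).trans (norm_reorder_le σ Φ)

/-- A sequence in the unit ball has a weak-star limit in the bidual along every ultrafilter. -/
theorem exists_bidual_limit {X : Type u} [NormedAddCommGroup X] [NormedSpace 𝕜 X]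
    (l : Ultrafilter ℕ) (x : ℕ → X) (hx : ∀ n, ‖x n‖ ≤ 1) :
    ∃ z : Bidual 𝕜 X, ‖z‖ ≤ 1 ∧
      ∀ φ : StrongDual 𝕜 X, Tendsto (fun n => φ (x n)) l (𝓝 (z φ)) := by
  let y : ℕ → WeakDual 𝕜 (StrongDual 𝕜 X) := fun n =>
    StrongDual.toWeakDual (NormedSpace.inclusionInDoubleDual 𝕜 X (x n))
  have hy : ∀ n, y n ∈ WeakDual.toStrongDual ⁻¹'
      Metric.closedBall (0 : StrongDual 𝕜 (StrongDual 𝕜 X)) 1 := fun n => by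
    change NormedSpace.inclusionInDoubleDual 𝕜 X (x n) ∈ Metric.closedBall _ _
    refine (mem_closedBall_zero_iff (E := StrongDual 𝕜 (StrongDual 𝕜 X))).2 ?_
    exact (NormedSpace.double_dual_bound 𝕜 X (x n)).trans (hx n)
  obtain ⟨z, hz, hlim⟩ := (WeakDual.isCompact_closedBall (𝕜 := 𝕜)
    (0 : StrongDual 𝕜 (StrongDual 𝕜 X)) 1).ultrafilter_le_nhds (l.map y)
    (le_principal_iff.2 (Filter.mem_map.2 (Filter.univ_mem' hy)))
  refine ⟨WeakDual.toStrongDual z,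
    (mem_closedBall_zero_iff (E := StrongDual 𝕜 (StrongDual 𝕜 X))).1 hz, fun φ => ?_⟩
  exact ((WeakDual.eval_continuous φ).tendsto z).comp (show Tendsto y l (𝓝 z) from hlim)

/-- The bound `c n₁ (c n₂ (⋯) + e n₂) + e n₁` of an iterated error. -/
def iteratedError (c e : ℕ → ℝ) : {N : ℕ} → (Fin N → ℕ) → ℝ
  | 0, _ => 0
  | _ + 1, n => c (n 0) * iteratedError c e (fun i => n i.succ) + e (n 0)

/-- Coordinates are replaced from the last to the first, so the innermost variable's error gets
multiplied by the factors of all outer ones. -/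
theorem le_iteratedError {c e : ℕ → ℝ} (hc : ∀ n, 0 ≤ c n) {N : ℕ} {X : Fin N → Type u}
    [∀ i, NormedAddCommGroup (X i)] (a : ℕ → ∀ i, X i) (ha : ∀ n i, ‖a n i‖ ≤ 1)
    (d : (∀ i, X i) → ℝ)
    (hd : ∀ x : ∀ i, X i, (∀ i, ‖x i‖ ≤ 1) → ∀ i n, d (update x i (a n i)) ≤ c n * d x + e n)
    (n : Fin N → ℕ) (x : ∀ i, X i) (hx : ∀ i, ‖x i‖ ≤ 1) :
    d (fun i => a (n i) i) ≤ (∏ i, c (n i)) * d x + iteratedError c e n := by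
  induction N with
  | zero =>
    rw [Subsingleton.elim (fun i => a (n i) i) x]
    simp [iteratedError]
  | succ N ih =>
    have hcons : ∀ (t : X 0) (y : ∀ i : Fin N, X i.succ), ‖t‖ ≤ 1 → (∀ i, ‖y i‖ ≤ 1) →
        ∀ i, ‖(Fin.cons t y : ∀ i, X i) i‖ ≤ 1 := fun t y ht hy i => by
      refine Fin.cases ?_ (fun j => ?_) i
      · simpa using ht
      · simpa using hy j
    have h1 := ih (fun k i => a k i.succ) (fun k i => ha k i.succ)
      (fun y => d (Fin.cons (x 0) y)) (fun y hy i k => by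
        rw [Fin.cons_update]
        exact hd _ (hcons _ y (hx 0) hy) i.succ k)
      (fun i => n i.succ) (fun i => x i.succ) (fun i => hx i.succ)
    have h2 := hd (Fin.cons (x 0) fun i => a (n i.succ) i.succ)
      (hcons _ _ (hx 0) fun i => ha _ _) 0 (n 0)
    have e1 : update (Fin.cons (x 0) fun i => a (n i.succ) i.succ : ∀ i, X i) 0 (a (n 0) 0) =
        fun i => a (n i) i := by
      rw [Fin.update_cons_zero]
      exact Fin.cons_self_tail (fun i => a (n i) i)
    have e2 : (Fin.cons (x 0) fun i => x i.succ : ∀ i, X i) = x := Fin.cons_self_tail x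
    rw [e1] at h2
    simp only [e2] at h1
    have h3 := mul_le_mul_of_nonneg_left h1 (hc (n 0))
    rw [Fin.prod_univ_succ, iteratedError]
    linarith

/-- `A` collects the factors `c` of the outer variables. These are fixed while an inner limit is
taken, so boundedness of `c` is not needed. -/
theorem le_norm_arensEval {c e : ℕ → ℝ} (hc : ∀ n, 0 ≤ c n) (l : Filter ℕ) [l.NeBot]
    (he : Tendsto e l (𝓝 0)) {N : ℕ} (X : Fin N → Type u)
    [∀ i, NormedAddCommGroup (X i)] [∀ i, NormedSpace 𝕜 (X i)] (a : ℕ → ∀ i, X i)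
    (z : ∀ i, Bidual 𝕜 (X i))
    (hz : ∀ i, ∀ φ : StrongDual 𝕜 (X i), Tendsto (fun n => φ (a n i)) l (𝓝 (z i φ)))
    (Φ : Form 𝕜 X) (s A : ℝ) (hA : 0 ≤ A)
    (h : ∀ n : Fin N → ℕ, s - A * iteratedError c e n ≤ ‖Φ fun i => a (n i) i‖) :
    s ≤ ‖arensEval 𝕜 X z Φ‖ := by
  induction N generalizing s A with
  | zero =>
    have := h 0
    rw [Subsingleton.elim (fun i => a ((0 : Fin 0 → ℕ) i) i) 0] at this
    simpa [iteratedError, arensEval_zero] using this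
  | succ N ih =>
    have hlim : Tendsto (fun n => s - A * e n) l (𝓝 s) := by
      simpa using (he.const_mul A).const_sub s
    refine le_of_tendsto_of_tendsto' hlim
      (tendsto_arensEval 𝕜 X z Φ l (fun n => a n 0) (hz 0)).norm fun k => ?_
    refine ih (fun i => X i.succ) (fun n i => a n i.succ) (fun i => z i.succ)
      (fun i => hz i.succ) (Φ.curryLeft (a k 0)) _ (A * c k) (mul_nonneg hA (hc k)) fun n => ?_
    have h1 := h (Fin.cons k n)
    have e1 : (Fin.cons (a k 0) fun i => a (n i) i.succ : ∀ i, X i) =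
        fun i => a ((Fin.cons k n : Fin (N + 1) → ℕ) i) i := by
      funext i
      refine Fin.cases ?_ (fun j => ?_) i <;> simp
    rw [ContinuousMultilinearMap.curryLeft_apply, e1]
    refine le_trans (le_of_eq ?_) h1
    simp [iteratedError]
    ring

theorem arensAttain_of_defect {N : ℕ} {X : Fin N → Type u}
    [∀ i, NormedAddCommGroup (X i)] [∀ i, NormedSpace 𝕜 (X i)] (Ψ : Form 𝕜 X)
    {c e : ℕ → ℝ} (hc : ∀ n, 0 ≤ c n) (he : Tendsto e atTop (𝓝 0))
    (a : ℕ → ∀ i, X i) (ha : ∀ n i, ‖a n i‖ ≤ 1) (hnorm : ∀ n, ‖Ψ‖ - ‖Ψ (a n)‖ ≤ e n)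
    (hd : ∀ x : ∀ i, X i, (∀ i, ‖x i‖ ≤ 1) → ∀ i n,
      ‖Ψ‖ - ‖Ψ (update x i (a n i))‖ ≤ c n * (‖Ψ‖ - ‖Ψ x‖) + e n) :
    ArensAttain Ψ := by
  choose z hz1 hz using fun i =>
    exists_bidual_limit (𝕜 := 𝕜) (hyperfilter ℕ) (fun n => a n i) fun n => ha n i
  refine ⟨z, hz1, fun σ w hw => (norm_arens_le σ Ψ w hw).trans ?_⟩
  have hl : ((hyperfilter ℕ : Ultrafilter ℕ) : Filter ℕ) ≤ atTop :=
    Nat.hyperfilter_le_atTop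
  refine le_norm_arensEval hc (hyperfilter ℕ : Ultrafilter ℕ) (he.mono_left hl)
    (fun k => X (σ.symm k)) (fun n k => a n (σ.symm k)) _ (fun k => hz (σ.symm k)) _ _ 1
    zero_le_one fun n => ?_
  -- The starting point `a m` is independent of the indices `n`, so `m → ∞` removes the product of
  -- the `c (n i)`.
  have key : ∀ m, ‖Ψ‖ - ‖reorder σ Ψ fun k => a (n k) (σ.symm k)‖ ≤
      (∏ i, c (n i)) * e m + iteratedError c e n := fun m => by
    refine (le_iteratedError (e := e) hc (fun n k => a n (σ.symm k)) (fun n k => ha n _)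
      (fun y => ‖Ψ‖ - ‖reorder σ Ψ y‖) ?_ n (fun k => a m (σ.symm k)) fun k => ha m _).trans ?_
    · intro y hy k p
      obtain ⟨x, rfl⟩ := (σ.piCongrLeft' X).surjective y
      have e1 : update (σ.piCongrLeft' X x) k (a p (σ.symm k)) =
          fun j => update x (σ.symm k) (a p (σ.symm k)) (σ.symm j) := by
        funext j
        by_cases hj : j = k
        · subst hj; simp
        · simp [hj]
      have e2 : reorder σ Ψ (σ.piCongrLeft' X x) = Ψ x := reorder_apply σ Ψ x
      simp only [e1, e2, reorder_apply]
      refine hd x (fun i => ?_) _ p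
      obtain ⟨j, rfl⟩ := σ.symm.surjective i
      exact hy j
    · simp only [reorder_apply]
      have := mul_le_mul_of_nonneg_left (hnorm m)
        (Finset.prod_nonneg fun i (_ : i ∈ Finset.univ) => hc (n i))
      linarith
  have hlim : Tendsto (fun m => (∏ i, c (n i)) * e m + iteratedError c e n) atTop
      (𝓝 (iteratedError c e n)) := by
    simpa using (he.const_mul (∏ i, c (n i))).add_const (iteratedError c e n)
  have := ge_of_tendsto' hlim key
  linarith

end Arens

/-! ### Ideal norm estimates. -/

section Ideals

variable {𝕜 : Type} [RCLike 𝕜] {N : ℕ} (U : NormedIdeal.{u} 𝕜 N) (X : Fin N → Type u)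
  [∀ i, NormedAddCommGroup (X i)] [∀ i, NormedSpace 𝕜 (X i)] [∀ i, CompleteSpace (X i)]

/-- Composing with the maps `t ↦ t • x i` turns `Φ` into `Φ(x)` times the product form, which has
ideal norm one. -/
theorem NormedIdeal.norm_le_nrm (Φ : U.space X) : ‖(Φ : Form 𝕜 X)‖ ≤ U.nrm X Φ := by
  refine norm_le_of_forall_ball _ (apply_nonneg _ _) fun x hx => ?_
  let T : ∀ i, ULift.{u} 𝕜 →L[𝕜] X i := fun i =>
    (ContinuousLinearMap.toSpanSingleton 𝕜 (x i)).comp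
      (ContinuousLinearEquiv.ulift (R₁ := 𝕜) (M₁ := 𝕜)).toContinuousLinearMap
  have hT : ∀ i, ‖T i‖ ≤ 1 := fun i =>
    ContinuousLinearMap.opNorm_le_bound _ zero_le_one fun t => by
      change ‖t.down • x i‖ ≤ 1 * ‖t.down‖
      rw [norm_smul, one_mul]
      exact mul_le_of_le_one_right (norm_nonneg _) (hx i)
  obtain ⟨h, hle⟩ := U.comp_mem X (fun _ => ULift.{u} 𝕜) T Φ
  obtain ⟨h1, hnorm⟩ := U.mul_mem
  have heq : (⟨_, h⟩ : U.space fun _ => ULift.{u} 𝕜) = (Φ : Form 𝕜 X) x • ⟨_, h1⟩ := by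
    refine Subtype.ext (ContinuousMultilinearMap.ext fun t => ?_)
    change (Φ : Form 𝕜 X) (fun i => (t i).down • x i) = (Φ : Form 𝕜 X) x • mulForm 𝕜 N t
    rw [(Φ : Form 𝕜 X).map_smul_univ, mulForm_apply, smul_eq_mul, smul_eq_mul, mul_comm]
  rw [heq, map_smul_eq_mul, hnorm, mul_one] at hle
  exact hle.trans (mul_le_of_le_one_right (apply_nonneg _ _)
    (Finset.prod_le_one (fun i _ => norm_nonneg _) fun i _ => hT i))

theorem NormedIdeal.exists_perturbation {K : ℝ} (hK : 0 < K)
    (hstable : ∀ (a : ∀ i, X i) (J : Finset (Fin N)) (Φ : U.space X),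
      ∃ h : V J a (Φ : Form 𝕜 X) ∈ U.space X,
        U.nrm X ⟨_, h⟩ ≤ K * U.nrm X Φ ^ 2 * ∏ i, ‖a i‖)
    {ε δ : ℝ} (hε : 0 < ε) (hδ : 0 < δ) (Φ : U.space X) :
    ∃ (a : ∀ i, X i) (Φ' : U.space X), (∀ i, ‖a i‖ ≤ 1) ∧
      U.nrm X (Φ' - Φ) ≤ ε * (N * (K * U.nrm X Φ ^ 2)) ∧
      ‖(Φ : Form 𝕜 X)‖ - δ ≤ ‖(Φ : Form 𝕜 X) a‖ ∧
      ∀ x : ∀ i, X i, (∀ i, ‖x i‖ ≤ 1) → ∀ i,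
        ε * (‖(Φ : Form 𝕜 X)‖ * (‖(Φ : Form 𝕜 X)‖ - ‖(Φ : Form 𝕜 X) (update x i (a i))‖)) ≤
          2 * N * ‖(Φ : Form 𝕜 X)‖ * δ * ε + δ +
            (‖(Φ' : Form 𝕜 X)‖ - ‖(Φ' : Form 𝕜 X) x‖) := by
  obtain ⟨a, u, ha, hu, hΦa, h⟩ :=
    MultilinearLindenstrauss.exists_perturbation (Φ : Form 𝕜 X) hε hδ
  choose hV hnrm using fun i : Fin N => hstable a {i} Φ
  refine ⟨a, Φ + ((ε : 𝕜) * u) • ∑ i, ⟨_, hV i⟩, ha, ?_, hΦa, h _ (by simp)⟩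
  refine (congrArg (U.nrm X) (add_sub_cancel_left Φ _)).le.trans ?_
  rw [map_smul_eq_mul, norm_mul, RCLike.norm_ofReal, abs_of_pos hε]
  refine mul_le_mul (mul_le_of_le_one_right hε.le hu) ?_ (apply_nonneg _ _) hε.le
  have hsum := Finset.le_sum_of_subadditive (U.nrm X) (map_zero _).le (map_add_le_add _)
    Finset.univ fun i => (⟨_, hV i⟩ : U.space X)
  refine hsum.trans ((Finset.sum_le_card_nsmul _ _ (K * U.nrm X Φ ^ 2) fun i _ => ?_).trans_eq
    (by simp))
  exact (hnrm i).trans (mul_le_of_le_one_right (by positivity)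
    (Finset.prod_le_one (fun i _ => norm_nonneg _) fun i _ => ha i))

end Ideals

/-! ### Convergence of the iteration. -/

section Iteration

theorem exists_limit_of_controlled_steps {𝕜 : Type} [RCLike 𝕜] {E : Type*} [AddCommGroup E]
    [Module 𝕜 E] (p : Seminorm 𝕜 E)
    (hcomplete : ∀ f : ℕ → E, (∀ ε > 0, ∃ n₀, ∀ m ≥ n₀, ∀ n ≥ n₀, p (f m - f n) < ε) →
      ∃ g, Tendsto (fun n => p (f n - g)) atTop (𝓝 0))
    (x : E) {r : ℕ → ℝ} (hr : ∀ n, 0 ≤ r n) (hr0 : Tendsto r atTop (𝓝 0)) {R : ℝ}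
    (hR : p x + r 0 ≤ R) (F : ℕ → E → E)
    (hF : ∀ n y, p y ≤ R → p (F n y - y) ≤ r n - r (n + 1)) :
    ∃ (f : ℕ → E) (g : E), f 0 = x ∧ (∀ n, f (n + 1) = F n (f n)) ∧
      ∀ n, p (f n - g) ≤ r n := by
  let f : ℕ → E := fun n => Nat.rec x (fun n y => F n y) n
  have hf : ∀ n, f (n + 1) = F n (f n) := fun n => rfl
  -- The step bound holds only where `p ≤ R`; the telescoping budget `r n` keeps the iterates there.
  have hinv : ∀ n, p (f n) + r n ≤ R := by
    intro n
    induction n with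
    | zero => exact hR
    | succ n ih =>
      have h1 := hF n (f n) (by linarith [hr n])
      have h2 := map_add_le_add p (F n (f n) - f n) (f n)
      rw [sub_add_cancel] at h2
      rw [hf]
      linarith
  have htri : ∀ a b c : E, p (a - c) ≤ p (a - b) + p (b - c) := fun a b c => by
    simpa using map_add_le_add p (a - b) (b - c)
  have hdiff : ∀ n m, n ≤ m → p (f m - f n) ≤ r n - r m := by
    intro n m hnm
    induction m, hnm using Nat.le_induction with
    | base => simp
    | succ m _ ih =>
      have h1 := hF m (f m) (by linarith [hr m, hinv m])
      rw [← hf] at h1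
      linarith [htri (f (m + 1)) (f m) (f n)]
  have hdiff' : ∀ n m, n ≤ m → p (f m - f n) ≤ r n := fun n m hnm =>
    (hdiff n m hnm).trans (sub_le_self _ (hr m))
  obtain ⟨g, hg⟩ := hcomplete f fun τ hτ => by
    obtain ⟨n₀, hn₀⟩ := (hr0.eventually (gt_mem_nhds (half_pos hτ))).exists
    refine ⟨n₀, fun m hm n hn => ?_⟩
    have h1 := htri (f m) (f n₀) (f n)
    rw [map_sub_rev p (f n₀)] at h1
    linarith [hdiff' n₀ m hm, hdiff' n₀ n hn]
  refine ⟨f, g, rfl, hf, fun n => ?_⟩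
  refine ge_of_tendsto (by simpa using hg.const_add (r n)) ?_
  filter_upwards [eventually_ge_atTop n] with m hm
  have h1 := htri (f n) (f m) g
  rw [map_sub_rev p (f n) (f m)] at h1
  linarith [hdiff' n m hm]

end Iteration

/-! ### Passing the defect inequality to the limit form. -/

section Limit

variable {𝕜 : Type} [RCLike 𝕜] {N : ℕ} {X : Fin N → Type u}
  [∀ i, NormedAddCommGroup (X i)] [∀ i, NormedSpace 𝕜 (X i)]

theorem arensAttain_of_norm_eq_zero (Ψ : Form 𝕜 X) (h : ‖Ψ‖ = 0) : ArensAttain Ψ :=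
  ⟨fun _ => 0, fun i =>
    (norm_zero (E := Bidual 𝕜 (X i))).trans_le zero_le_one, fun σ w hw => ((norm_arens_le σ Ψ w hw).trans_eq h).trans (norm_nonneg _)⟩

/-- Dividing the step inequality by `ε n * ‖f n‖` and replacing `f n`, `f (n + 1)` by `Ψ` costs `2 *
ρ n` and `2 * ρ (n + 1)`. The latter cost is divided by `ε n`, whence `hquot`. -/
theorem arensAttain_of_perturbations (Ψ : Form 𝕜 X) (f : ℕ → Form 𝕜 X) (a : ℕ → ∀ i, X i)
    {ε δ ρ : ℕ → ℝ} (hε : ∀ n, 0 < ε n) (hδ : ∀ n, 0 ≤ δ n) (hρ : ∀ n, ‖f n - Ψ‖ ≤ ρ n)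
    (hδ0 : Tendsto δ atTop (𝓝 0)) (hρ0 : Tendsto ρ atTop (𝓝 0))
    (hquot : Tendsto (fun n => (δ n + 2 * ρ (n + 1)) / ε n) atTop (𝓝 0))
    (ha : ∀ n i, ‖a n i‖ ≤ 1) (hnorm : ∀ n, ‖f n‖ - δ n ≤ ‖f n (a n)‖)
    (hstep : ∀ n, ∀ x : ∀ i, X i, (∀ i, ‖x i‖ ≤ 1) → ∀ i,
      ε n * (‖f n‖ * (‖f n‖ - ‖f n (update x i (a n i))‖)) ≤
        2 * N * ‖f n‖ * δ n * ε n + δ n + (‖f (n + 1)‖ - ‖f (n + 1) x‖)) :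
    ArensAttain Ψ := by
  rcases (norm_nonneg Ψ).eq_or_lt with h0 | hpos
  · exact arensAttain_of_norm_eq_zero Ψ h0.symm
  have hρn : ∀ n, 0 ≤ ρ n := fun n => (norm_nonneg _).trans (hρ n)
  have hnear : ∀ n, |‖f n‖ - ‖Ψ‖| ≤ ρ n := fun n => (abs_norm_sub_norm_le _ _).trans (hρ n)
  have hnear' : ∀ n, ∀ x : ∀ i, X i, (∀ i, ‖x i‖ ≤ 1) → |‖f n x‖ - ‖Ψ x‖| ≤ ρ n :=
    fun n x hx => (abs_norm_sub_norm_le _ _).trans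
      ((norm_apply_le_of_ball (f n - Ψ) hx).trans (hρ n))
  have hS : Tendsto (fun n => ‖f n‖) atTop (𝓝 ‖Ψ‖) := by
    rw [tendsto_iff_norm_sub_tendsto_zero]
    exact squeeze_zero (fun n => norm_nonneg _) hnear hρ0
  refine arensAttain_of_defect Ψ (c := fun n => 1 / (ε n * ‖f n‖))
    (e := fun n => 2 * ρ n + (2 * N + 1) * δ n + (δ n + 2 * ρ (n + 1)) / ε n / ‖f n‖)
    (fun n => div_nonneg zero_le_one (mul_nonneg (hε n).le (norm_nonneg _))) ?_ a ha
    (fun n => ?_) fun x hx i n => ?_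
  · simpa using ((hρ0.const_mul 2).add (hδ0.const_mul (2 * (N : ℝ) + 1))).add
      (hquot.div hS hpos.ne')
  · have h1 := abs_le.1 (hnear n)
    have h2 := abs_le.1 (hnear' n (a n) (ha n))
    have h3 : 0 ≤ (δ n + 2 * ρ (n + 1)) / ε n / ‖f n‖ :=
      div_nonneg (div_nonneg (by linarith [hδ n, hρn (n + 1)]) (hε n).le) (norm_nonneg _)
    have h4 : 0 ≤ 2 * N * δ n := by have := hδ n; positivity
    linarith [hnorm n]
  · have h1 := abs_le.1 (hnear n)
    have h2 := abs_le.1 (hnear' n _ (norm_update_le_one (ha n) hx i))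
    have h5 := abs_le.1 (hnear (n + 1))
    have h6 := abs_le.1 (hnear' (n + 1) x hx)
    have h7 := norm_apply_le_of_ball Ψ hx
    rcases (norm_nonneg (f n)).eq_or_lt with h0 | hf
    -- If `f n = 0`, the divisions yield `0`, but `‖Ψ‖ ≤ ρ n` suffices.
    · simp only [← h0, mul_zero, div_zero, zero_mul, add_zero, zero_add]
      have h4 : 0 ≤ (2 * N + 1) * δ n := by have := hδ n; positivity
      linarith [norm_nonneg (Ψ (update x i (a n i))), hρn n]
    · have h8 : ‖f n‖ - ‖f n (update x i (a n i))‖ ≤ 2 * N * δ n +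
          (δ n + 2 * ρ (n + 1) + (‖Ψ‖ - ‖Ψ x‖)) / (ε n * ‖f n‖) := by
        have hp := mul_pos (hε n) hf
        have e1 : 2 * N * δ n + (δ n + 2 * ρ (n + 1) + (‖Ψ‖ - ‖Ψ x‖)) / (ε n * ‖f n‖) =
            (2 * N * ‖f n‖ * δ n * ε n + (δ n + 2 * ρ (n + 1) + (‖Ψ‖ - ‖Ψ x‖))) /
              (ε n * ‖f n‖) := by
          rw [eq_div_iff hp.ne', add_mul, div_mul_cancel₀ _ hp.ne']
          ring
        rw [e1, le_div_iff₀ hp]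
        linarith [hstep n x hx i]
      rw [add_div, ← div_div] at h8
      have e2 : 1 / (ε n * ‖f n‖) * (‖Ψ‖ - ‖Ψ x‖) = (‖Ψ‖ - ‖Ψ x‖) / (ε n * ‖f n‖) := by ring
      simp only [e2]
      linarith [hδ n]

end Limit

end MultilinearLindenstrauss

/-! ### Choice of the parameters and conclusion. -/

open MultilinearLindenstrauss in
theorem mainTheorem1 (𝕜 : Type) [RCLike 𝕜] (N : ℕ)
    (U : MultilinearLindenstrauss.NormedIdeal.{u} 𝕜 N)
    (X : Fin N → Type u) [∀ i, NormedAddCommGroup (X i)] [∀ i, NormedSpace 𝕜 (X i)]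
    [∀ i, CompleteSpace (X i)]
    (hcomplete : U.CompleteAt X) (hstable : U.StableAt X) :
    ∀ Φ : U.space X, ∀ ε : ℝ, 0 < ε →
      ∃ Ψ : U.space X,
        MultilinearLindenstrauss.ArensAttain
          (Ψ : MultilinearLindenstrauss.Form 𝕜 X) ∧ U.nrm X (Φ - Ψ) < ε := by
  intro Φ ε hε
  obtain ⟨K, hK, hV⟩ := hstable
  set η : ℝ := min ε 1 / 2 with hη
  have hη0 : 0 < η := by positivity
  have hη1 : η ≤ 1 := by linarith [min_le_right ε 1]
  have hηε : η < ε := by linarith [min_le_left ε 1, lt_min hε one_pos]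
  set R : ℝ := U.nrm X Φ + 1 with hR
  have hR0 : 0 < R := by have := apply_nonneg (U.nrm X) Φ; positivity
  set B : ℝ := N * (K * R ^ 2) + 1 with hB
  have hB0 : 0 < B := by positivity
  -- The remaining distance after a step must be negligible against that step; factorial decay gives
  -- the ratio `1 / (n + 1)`, which a geometric sequence would not.
  let q : ℕ → ℝ := fun n => ((n + 1).factorial : ℝ)⁻¹
  have hq0 : ∀ n, 0 < q n := fun n => by positivity
  have hq : ∀ n : ℕ, q n - q (n + 1) = (n + 1) * q (n + 1) := fun n => by
    simp only [q, Nat.factorial_succ (n + 1)]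
    push_cast
    field_simp
    ring
  have hqlim : Tendsto q atTop (𝓝 0) :=
    tendsto_inv_atTop_zero.comp (tendsto_natCast_atTop_atTop.comp
      (factorial_tendsto_atTop.comp (tendsto_add_atTop_nat 1)))
  have hr : ∀ n, 0 < q n - q (n + 1) := fun n => by
    rw [hq]; have := hq0 (n + 1); positivity
  -- `B` bounds the ideal norm of the added sum on the ball of radius `R`, so step `n` has size at
  -- most `η * (q n - q (n + 1))`.
  let ε' : ℕ → ℝ := fun n => η * (q n - q (n + 1)) / B
  have hε' : ∀ n, 0 < ε' n := fun n => div_pos (mul_pos hη0 (hr n)) hB0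
  have hε'lim : Tendsto ε' atTop (𝓝 0) := by
    simpa using ((hqlim.sub (hqlim.comp (tendsto_add_atTop_nat 1))).const_mul η).div_const B
  choose a F ha hF hnorm hstep using fun (n : ℕ) (Φ : U.space X) =>
    U.exists_perturbation X hK hV (hε' n) (mul_pos (hε' n) (hq0 n)) Φ
  have hρlim : Tendsto (fun n => η * q n) atTop (𝓝 0) := by simpa using hqlim.const_mul η
  obtain ⟨f, Ψ, hf0, hf, hfΨ⟩ := exists_limit_of_controlled_steps (U.nrm X) hcomplete Φ
    (r := fun n => η * q n) (R := R) (fun n => (mul_pos hη0 (hq0 n)).le) hρlim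
    (by simp [q, hR, hη1]) F fun n Φ₁ hΦ₁ => by
      refine (hF n Φ₁).trans ?_
      have h1 : N * (K * U.nrm X Φ₁ ^ 2) ≤ N * (K * R ^ 2) := by
        have := apply_nonneg (U.nrm X) Φ₁
        gcongr
      refine (mul_le_mul_of_nonneg_left (h1.trans (le_add_of_nonneg_right zero_le_one))
        (hε' n).le).trans_eq ?_
      rw [← mul_sub]
      exact div_mul_cancel₀ _ hB0.ne'
  refine ⟨Ψ, ?_, ?_⟩
  · refine arensAttain_of_perturbations (Ψ : Form 𝕜 X) (fun n => (f n : Form 𝕜 X))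
      (fun n => a n (f n)) hε' (fun n => (mul_pos (hε' n) (hq0 n)).le)
      (fun n => (U.norm_le_nrm X (f n - Ψ)).trans (hfΨ n)) (by simpa using hε'lim.mul hqlim)
      hρlim ?_ (fun n => ha n (f n)) (fun n => hnorm n (f n)) fun n => by
        rw [hf]; exact hstep n (f n)
    have hlim : Tendsto (fun n : ℕ => q n + 2 * B * (1 / ((n : ℝ) + 1))) atTop (𝓝 0) := by
      simpa using hqlim.add (tendsto_one_div_add_atTop_nhds_zero_nat.const_mul (2 * B))
    refine hlim.congr fun n => ?_
    have h1 := (hε' n).ne'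
    have h2 := (hq0 (n + 1)).ne'
    have h3 : (n : ℝ) + 1 ≠ 0 := by positivity
    have h4 : ε' n * B = η * ((n + 1) * q (n + 1)) := by
      rw [← hq]; exact div_mul_cancel₀ _ hB0.ne'
    rw [eq_div_iff h1]
    field_simp
    linear_combination 2 * h4
  · have h1 := hfΨ 0
    rw [hf0] at h1
    refine h1.trans_lt ?_
    simpa [q] using hηε
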